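/- For $n\le N$ let $Q_n$ denote the set of all subsets of $[n]=\{1,\dots,n\}$ ordered by inclusion. An embedding of $Q_n$ into $Q_N$ is an injective map $f:Q_n\to Q_N$ such that $A\subseteq B$ if and only if $f(A)\subseteq f(B)$ for all $A,B\in Q_n$. Let $e(n,N)$ be the number of embeddings of $Q_n$ into $Q_N$, and let $a(n)$ be the number of antichains in $Q_n$ (including the empty antichain). Then for all integers $0\le n\le N$, $$\frac{N!}{(N-n)!}\,(a(n)-n)^{N-n}\;\le\; e(n,N)\;\le\;\frac{N!}{(N-n)!}\,a(n)^{N-n}.$$ In particular, for all $N>n$, $$e(n,N)=2^{\binom{n}{\lfloor n/2\rfloor}(N-n)(1+\varepsilon(n,N))},$$ where $\varepsilon(n,N)\to 0$ as $n\to\infty$, uniformly in $N>n$; that is, for every $\eta>0$ there is $n_0$ such that $|\varepsilon(n,N)|\le\eta$ whenever $n\ge n_0$ and $N>n$. -/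

import Mathlib

/-- The Boolean lattice `Q n`: all subsets of an `n`-element ground set, ordered by inclusion. -/
abbrev BooleanLattice (n : ℕ) : Type := Finset (Fin n)

/-- `e n N`: the number of embeddings of the Boolean lattice of dimension `n` into the one of
dimension `N`. An order embedding is an injective map with `f A ≤ f B ↔ A ≤ B`. -/
noncomputable def numEmbeddings (n N : ℕ) : ℕ :=
  Nat.card (BooleanLattice n ↪o BooleanLattice N)

/-- `a n`: the number of antichains (the empty one included) in the Boolean lattice of
dimension `n`. -/
noncomputable def numAntichains (n : ℕ) : ℕ :=
  Nat.card {A : Set (BooleanLattice n) // IsAntichain (· ≤ ·) A}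

/-! An embedding `f` is determined by the upper sets `{A | k ∈ f A}`, one for each coordinate `k`.
An `N`-tuple of upper sets always gives a monotone map, and this map reflects inclusion exactly when
every principal filter of a singleton `{i}` occurs in the tuple. So `numEmbeddings n N` counts
functions from `N` points to `a(n)` values that hit `n` prescribed values. Placing those values
along an injection and filling the other `N - n` points, freely or avoiding the prescribed values,
gives the two bounds (`numEmbeddings_le`, `le_numEmbeddings`).

The asymptotics need `log₂ a(n) ~ M`, where `M = n.choose (n / 2)`. The lower bound takes subsets of
the middle layer. For the upper bound, averaging over maximal chains shows that a family of more
than `nM/(n-d)` proper nonempty sets has a member comparable to more than `d` others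
(`card_le_of_card_comparable_le`). Branching on such members bounds the number of independent sets
of the comparability graph (`SimpleGraph.numIndep_le`). -/

/-! ### Functions hitting prescribed values. -/

theorem Fintype.card_compl_range_embedding {ι α : Type*} [Fintype ι] [Fintype α] (j : ι ↪ α) :
    Nat.card {x // x ∉ Set.range j} = Fintype.card α - Fintype.card ι := by
  classical
  rw [Nat.card_eq_fintype_card, Fintype.card_subtype_compl]
  congr 1
  exact (Fintype.card_congr (Equiv.ofInjective j j.injective)).symm

/-- Combine values prescribed along an embedding with values off its range. -/
noncomputable def Function.Embedding.glue {ι α β : Type*} (s : ι → β) (j : ι ↪ α)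
    (h : {x // x ∉ Set.range j} → β) (x : α) : β :=
  open Classical in if hx : x ∈ Set.range j then s hx.choose else h ⟨x, hx⟩

theorem Function.Embedding.glue_apply {ι α β : Type*} (s : ι → β) (j : ι ↪ α)
    (h : {x // x ∉ Set.range j} → β) (i : ι) : j.glue s h (j i) = s i := by
  have hx : j i ∈ Set.range j := ⟨i, rfl⟩
  rw [Function.Embedding.glue, dif_pos hx, j.injective hx.choose_spec]

theorem Function.Embedding.glue_of_notMem {ι α β : Type*} (s : ι → β) (j : ι ↪ α)
    (h : {x // x ∉ Set.range j} → β) {x : α} (hx : x ∉ Set.range j) :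
    j.glue s h x = h ⟨x, hx⟩ := by
  rw [Function.Embedding.glue, dif_neg hx]

theorem card_sigma_embedding {ι α β : Type*} [Fintype ι] [Fintype α] [Finite β] :
    Nat.card (Σ j : ι ↪ α, ({x // x ∉ Set.range j} → β)) =
      (Fintype.card α).descFactorial (Fintype.card ι) *
        Nat.card β ^ (Fintype.card α - Fintype.card ι) := by
  classical
  rw [Nat.card_sigma]
  simp only [Nat.card_fun, Fintype.card_compl_range_embedding]
  rw [Finset.sum_const, Finset.card_univ, Fintype.card_embedding_eq, smul_eq_mul]

/-- Choosing a preimage of each prescribed value shows that gluing is onto; it overcounts when a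
value is hit more than once. -/
theorem card_functions_hitting_le {ι α β : Type*} [Fintype ι] [Fintype α] [Finite β]
    (s : ι ↪ β) :
    Nat.card {g : α → β // ∀ i, ∃ x, g x = s i} ≤
      (Fintype.card α).descFactorial (Fintype.card ι) *
        Nat.card β ^ (Fintype.card α - Fintype.card ι) := by
  rw [← card_sigma_embedding]
  refine Nat.card_le_card_of_surjective
    (fun p => ⟨p.1.glue s p.2, fun i => ⟨p.1 i, p.1.glue_apply s p.2 i⟩⟩) ?_
  rintro ⟨g, hg⟩
  have hg' := hg
  choose j hj using hg'
  let j' : ι ↪ α := ⟨j, fun a b hab => s.injective (by rw [← hj a, ← hj b, hab])⟩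
  refine ⟨⟨j', fun x => g x⟩, Subtype.ext (funext fun x => ?_)⟩
  by_cases hx : x ∈ Set.range j'
  · obtain ⟨i, rfl⟩ := hx
    exact (j'.glue_apply _ _ i).trans (hj i).symm
  · exact j'.glue_of_notMem _ _ hx

/-- If the free values avoid the range of `s`, each prescribed value has a unique preimage, so the
injection can be recovered from the glued function. -/
theorem le_card_functions_hitting {ι α β : Type*} [Fintype ι] [Fintype α] [Finite β]
    (s : ι ↪ β) :
    (Fintype.card α).descFactorial (Fintype.card ι) *
        (Nat.card β - Fintype.card ι) ^ (Fintype.card α - Fintype.card ι) ≤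
      Nat.card {g : α → β // ∀ i, ∃ x, g x = s i} := by
  have := Fintype.ofFinite β
  have hs := Fintype.card_compl_range_embedding s
  rw [← Nat.card_eq_fintype_card (α := β)] at hs
  rw [← hs, ← card_sigma_embedding]
  refine Nat.card_le_card_of_injective
    (fun p => ⟨p.1.glue s (fun x => p.2 x), fun i => ⟨p.1 i, p.1.glue_apply s _ i⟩⟩) ?_
  rintro ⟨j, h⟩ ⟨j', h'⟩ heq
  have heq : j.glue s (fun x => (h x : β)) = j'.glue s (fun x => (h' x : β)) :=
    congrArg Subtype.val heq
  have hj : j = j' := by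
    ext i
    have h1 := congrFun heq (j i)
    rw [j.glue_apply] at h1
    by_cases hx : j i ∈ Set.range j'
    · obtain ⟨i', hi'⟩ := hx
      rw [← hi', j'.glue_apply] at h1
      rw [← hi', s.injective h1]
    · rw [j'.glue_of_notMem _ _ hx] at h1
      exact absurd ⟨i, h1⟩ (h' _).2
  subst hj
  congr 1
  funext x
  have h1 := congrFun heq x
  rw [j.glue_of_notMem _ _ x.2, j.glue_of_notMem _ _ x.2] at h1
  exact Subtype.ext h1

/-! ### Embeddings as tuples of upper sets. -/

/-- In a finite poset, antichains correspond to upper sets. -/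
noncomputable def antichainEquivUpperSet (α : Type*) [PartialOrder α] [Finite α] :
    {A : Set α // IsAntichain (· ≤ ·) A} ≃ UpperSet α where
  toFun A := upperClosure A.1
  invFun U := ⟨{x | Minimal (· ∈ U) x}, setOfPred_minimal_antichain _⟩
  left_inv A := Subtype.ext (Set.ext fun x => A.2.minimal_mem_upperClosure_iff_mem)
  right_inv U := by
    ext x
    simp only [upperClosure, UpperSet.coe_mk, Set.mem_ofPred_eq, SetLike.mem_coe]
    constructor
    · rintro ⟨y, hy, hyx⟩
      exact U.upper hyx hy.1
    · intro hx
      obtain ⟨y, hyx, hy⟩ := (Set.toFinite (U : Set α)).exists_le_minimal hx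
      exact ⟨y, hy, hyx⟩

theorem numAntichains_eq_card_upperSet (n : ℕ) :
    numAntichains n = Nat.card (UpperSet (Finset (Fin n))) :=
  Nat.card_congr (antichainEquivUpperSet _)

/-- The family of sets containing a given element. -/
def starUpperSet {ι : Type*} : ι ↪ UpperSet (Finset ι) where
  toFun i := UpperSet.Ici {i}
  inj' i j h := by simpa using h

/-- Order embeddings of Boolean lattices, read coordinate by coordinate. -/
noncomputable def orderEmbeddingEquiv (ι κ : Type*) [Fintype ι] [DecidableEq ι] [Fintype κ]
    [DecidableEq κ] :
    (Finset ι ↪o Finset κ) ≃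
      {g : κ → UpperSet (Finset ι) // ∀ i, ∃ k, g k = starUpperSet i} where
  toFun f := ⟨fun k => ⟨{A | k ∈ f A}, fun _ _ hAB hA => f.monotone hAB hA⟩, by
    intro i
    -- A coordinate `k` in `f {i}` but not in `f {i}ᶜ` works: every set containing `i` lies above
    -- `{i}`, every other set lies below `{i}ᶜ`.
    have h : ¬ f {i} ≤ f {i}ᶜ := by
      rw [f.le_iff_le]; simp
    obtain ⟨k, hk, hk'⟩ := Finset.not_subset.1 h
    refine ⟨k, UpperSet.ext (Set.ext fun A => ?_)⟩
    change k ∈ f A ↔ {i} ⊆ A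
    constructor
    · intro hA
      by_contra hi
      refine hk' (f.monotone (fun x hx => ?_) hA)
      rw [Finset.mem_compl, Finset.mem_singleton]
      rintro rfl
      exact hi (Finset.singleton_subset_iff.2 hx)
    · exact fun hi => f.monotone hi hk⟩
  invFun g := OrderEmbedding.ofMapLEIff
    (fun A => open Classical in Finset.univ.filter fun k => A ∈ g.1 k) (by
      classical
      intro A B
      constructor
      · intro h i hi
        obtain ⟨k, hk⟩ := g.2 i
        have hA : A ∈ g.1 k := by
          rw [hk]; exact Finset.singleton_subset_iff.2 hi
        have hB : B ∈ g.1 k :=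
          (Finset.mem_filter.1 (h (Finset.mem_filter.2 ⟨Finset.mem_univ k, hA⟩))).2
        rw [hk] at hB
        exact Finset.singleton_subset_iff.1 hB
      · intro h k hk
        rw [Finset.mem_filter] at hk ⊢
        exact ⟨hk.1, (g.1 k).upper h hk.2⟩)
  left_inv f := by
    ext A k
    simp [← SetLike.mem_coe]
  right_inv g := by
    refine Subtype.ext (funext fun k => UpperSet.ext (Set.ext fun A => ?_))
    simp

theorem numEmbeddings_eq (n N : ℕ) :
    numEmbeddings n N = Nat.card {g : Fin N → UpperSet (Finset (Fin n)) //
      ∀ i, ∃ k, g k = starUpperSet i} :=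
  Nat.card_congr (orderEmbeddingEquiv (Fin n) (Fin N))

theorem numEmbeddings_le (n N : ℕ) :
    numEmbeddings n N ≤ N.descFactorial n * numAntichains n ^ (N - n) := by
  have h := card_functions_hitting_le (α := Fin N) (starUpperSet (ι := Fin n))
  rwa [Fintype.card_fin, Fintype.card_fin, ← numAntichains_eq_card_upperSet,
    ← numEmbeddings_eq] at h

theorem le_numEmbeddings (n N : ℕ) :
    N.descFactorial n * (numAntichains n - n) ^ (N - n) ≤ numEmbeddings n N := by
  have h := le_card_functions_hitting (α := Fin N) (starUpperSet (ι := Fin n))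
  rwa [Fintype.card_fin, Fintype.card_fin, ← numAntichains_eq_card_upperSet,
    ← numEmbeddings_eq] at h

/-! ### Families with few comparable pairs, by averaging over maximal chains. -/

theorem Nat.self_le_choose {m k : ℕ} (hk : 0 < k) (hkm : k < m) : m ≤ m.choose k := by
  induction m generalizing k with
  | zero => omega
  | succ m ih =>
    obtain ⟨k, rfl⟩ : ∃ j, k = j + 1 := ⟨k - 1, by omega⟩
    rw [Nat.choose_succ_succ']
    have h1 : 0 < m.choose (k + 1) := Nat.choose_pos (by omega)
    rcases Nat.eq_zero_or_pos k with rfl | hk0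
    · simp [add_comm]
    · have := ih hk0 (by omega)
      omega

theorem Nat.mul_factorial_mul_factorial_le {m k : ℕ} (hk : 0 < k) (hkm : k < m) :
    m * (k.factorial * (m - k).factorial) ≤ m.factorial := by
  rw [← Nat.choose_mul_factorial_mul_factorial hkm.le, mul_assoc]
  exact Nat.mul_le_mul_right _ (Nat.self_le_choose hk hkm)

namespace Numbering

variable {X : Type*} [Fintype X] [DecidableEq X]

theorem card_prefixed_inter_le {s t : Finset X} (hst : s ⊆ t) :
    (prefixed s ∩ prefixed t).card ≤
      s.card.factorial * (t.card - s.card).factorial *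
        (Fintype.card X - t.card).factorial := by
  let s' : Finset t := Finset.univ.filter fun x => (x : X) ∈ s
  have hs' : s'.card = s.card := by
    refine Finset.card_bij (fun x _ => (x : X)) (fun x hx => (Finset.mem_filter.1 hx).2)
      (fun x _ y _ h => Subtype.ext h) fun x hx => ⟨⟨x, hst hx⟩, ?_, rfl⟩
    exact Finset.mem_filter.2 ⟨Finset.mem_univ _, hx⟩
  have hcard : (prefixed s' ×ˢ (Finset.univ : Finset (Numbering ↑(tᶜ)))).card =
      s.card.factorial * (t.card - s.card).factorial *
        (Fintype.card X - t.card).factorial := by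
    rw [Finset.card_product, card_prefixed, hs', Finset.card_univ, Fintype.card_numbering]
    simp
  rw [← hcard]
  -- A numbering with prefix `t` splits into numberings of `t` and of its complement. The `else`
  -- value is a dummy, never reached on the intersection.
  refine Finset.card_le_card_of_injOn
    (fun f => if hf : f ∈ prefixed t then prefixedEquiv t ⟨f, hf⟩ else
      (Fintype.equivFin _, Fintype.equivFin _)) ?_ ?_
  · intro f hf
    obtain ⟨hfs, hft⟩ := Finset.mem_inter.1 (Finset.mem_coe.1 hf)
    beta_reduce
    rw [dif_pos hft, Finset.mem_coe, Finset.mem_product]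
    refine ⟨mem_prefixed.2 fun x => ?_, Finset.mem_univ _⟩
    rw [hs', Finset.mem_filter]
    have := mem_prefixed.1 hfs x
    simpa [prefixedEquiv] using this
  · intro f hf g hg hfg
    have hft := (Finset.mem_inter.1 (Finset.mem_coe.1 hf)).2
    have hgt := (Finset.mem_inter.1 (Finset.mem_coe.1 hg)).2
    simp only [dif_pos hft, dif_pos hgt] at hfg
    exact congrArg Subtype.val ((prefixedEquiv t).injective hfg)

/-- With `a = |s|` and `b = |t|`, the two terms on the right are at least `n - a` and `b` times the
intersection bound `a! (b-a)! (n-b)!`, and `(n - a) + b ≥ n`. Both factors need a nontrivial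
binomial coefficient, hence the exclusion of `∅` and `univ`. -/
theorem card_mul_card_prefixed_inter_le {s t : Finset X} (hst : s ⊂ t) (hs : s ≠ ∅)
    (ht : t ≠ Finset.univ) :
    Fintype.card X * (prefixed s ∩ prefixed t).card ≤
      (prefixed s).card + (prefixed t).card := by
  have h := card_prefixed_inter_le hst.1
  have hst' := Finset.card_lt_card hst
  have hs' := Finset.card_pos.2 (Finset.nonempty_iff_ne_empty.2 hs)
  have ht' : t.card < Fintype.card X := 
    (Finset.card_lt_iff_ne_univ t).2 ht
  rw [card_prefixed, card_prefixed]
  generalize (prefixed s ∩ prefixed t).card = c at *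
  generalize Fintype.card X = n at *
  have h1 := Nat.mul_factorial_mul_factorial_le hs' hst'
  have h2 := Nat.mul_factorial_mul_factorial_le (m := n - s.card) (k := t.card - s.card)
    (by omega) (by omega)
  rw [show n - s.card - (t.card - s.card) = n - t.card by omega] at h2
  calc n * c ≤ (n - s.card + t.card) * c := Nat.mul_le_mul_right _ (by omega)
    _ ≤ (n - s.card + t.card) * (s.card.factorial * (t.card - s.card).factorial *
        (n - t.card).factorial) := Nat.mul_le_mul_left _ h
    _ = s.card.factorial *
          ((n - s.card) * ((t.card - s.card).factorial * (n - t.card).factorial)) +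
        t.card * (s.card.factorial * (t.card - s.card).factorial) * (n - t.card).factorial := by
      ring
    _ ≤ _ := Nat.add_le_add (Nat.mul_le_mul_left _ h2) (Nat.mul_le_mul_right _ h1)

/-- The prefixes of `f` form a chain; pairing each other member with the largest one gives distinct
pairs. -/
theorem card_filter_isPrefix_le (F : Finset (Finset X)) (f : Numbering X) :
    (F.filter fun s => f ∈ prefixed s).card ≤
      1 + ((F ×ˢ F).filter fun p => p.1 ⊂ p.2 ∧ f ∈ prefixed p.1 ∩ prefixed p.2).card := by
  rcases (F.filter fun s => f ∈ prefixed s).eq_empty_or_nonempty with h | h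
  · rw [h]
    exact Nat.zero_le _
  obtain ⟨t, ht, hmax⟩ := Finset.exists_max_image _ Finset.card h
  rw [← Finset.card_erase_add_one ht, add_comm]
  refine Nat.add_le_add_left (Finset.card_le_card_of_injOn (fun s => (s, t)) ?_ ?_) 1
  · intro s hs
    obtain ⟨hst, hs⟩ := Finset.mem_erase.1 (Finset.mem_coe.1 hs)
    have hle := hmax s hs
    rw [Finset.mem_filter] at hs ht
    refine Finset.mem_coe.2 (Finset.mem_filter.2 ⟨Finset.mem_product.2 ⟨hs.1, ht.1⟩, ?_,
      Finset.mem_inter.2 ⟨hs.2, ht.2⟩⟩)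
    exact ((mem_prefixed.1 hs.2).subset_of_card_le_card (mem_prefixed.1 ht.2) hle).ssubset_of_ne
      hst
  · exact fun s _ s' _ hss => congrArg Prod.fst hss

theorem sum_card_prefixed_le {F : Finset (Finset X)} (h0 : ∅ ∉ F) (h1 : Finset.univ ∉ F)
    {d : ℕ} (hd : ∀ s ∈ F, (F.filter fun t => s < t ∨ t < s).card ≤ d) :
    Fintype.card X * ∑ s ∈ F, (prefixed s).card ≤
      Fintype.card X * (Fintype.card X).factorial + d * ∑ s ∈ F, (prefixed s).card := by
  have hsum : ∑ s ∈ F, (prefixed s).card =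
      ∑ f : Numbering X, (F.filter fun s => f ∈ prefixed s).card := by
    have := Finset.sum_card_bipartiteAbove_eq_sum_card_bipartiteBelow
      (s := F) (t := (Finset.univ : Finset (Numbering X))) (fun s f => f ∈ prefixed s)
    simpa only [Finset.bipartiteAbove, Finset.bipartiteBelow, Finset.filter_univ_mem] using this
  have hpairs : ∑ p ∈ (F ×ˢ F).filter (fun p => p.1 ⊂ p.2),
      (prefixed p.1 ∩ prefixed p.2).card =
      ∑ f : Numbering X,
        ((F ×ˢ F).filter fun p => p.1 ⊂ p.2 ∧ f ∈ prefixed p.1 ∩ prefixed p.2).card := by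
    have := Finset.sum_card_bipartiteAbove_eq_sum_card_bipartiteBelow
      (s := (F ×ˢ F).filter (fun p => p.1 ⊂ p.2)) (t := (Finset.univ : Finset (Numbering X)))
      (fun p f => f ∈ prefixed p.1 ∩ prefixed p.2)
    simp only [Finset.bipartiteAbove, Finset.bipartiteBelow, Finset.filter_filter] at this
    rw [← this]
    refine Finset.sum_congr rfl fun p _ => ?_
    congr 1
    ext f
    simp
  have hcount : ∑ s ∈ F, (prefixed s).card ≤ (Fintype.card X).factorial +
      ∑ p ∈ (F ×ˢ F).filter (fun p => p.1 ⊂ p.2), (prefixed p.1 ∩ prefixed p.2).card := by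
    rw [hsum, hpairs]
    refine (Finset.sum_le_sum fun f _ => card_filter_isPrefix_le F f).trans_eq ?_
    rw [Finset.sum_add_distrib]
    simp
  -- Each comparable pair charges both endpoints, so `s` is charged once per comparable partner, at
  -- most `d` times.
  have hdeg : ∑ p ∈ (F ×ˢ F).filter (fun p => p.1 ⊂ p.2),
      ((prefixed p.1).card + (prefixed p.2).card) ≤ d * ∑ s ∈ F, (prefixed s).card := by
    rw [Finset.sum_filter, Finset.sum_product]
    have hsplit : ∀ s t : Finset X, (if s ⊂ t then (prefixed s).card + (prefixed t).card else 0) =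
        (if s ⊂ t then (prefixed s).card else 0) + (if s ⊂ t then (prefixed t).card else 0) := by
      intro s t
      split_ifs <;> rfl
    simp only [hsplit, Finset.sum_add_distrib]
    rw [Finset.sum_comm (f := fun s t : Finset X => if s ⊂ t then (prefixed t).card else 0),
      ← Finset.sum_add_distrib, Finset.mul_sum]
    refine Finset.sum_le_sum fun s hs => ?_
    rw [← Finset.sum_filter, ← Finset.sum_filter, Finset.sum_const, Finset.sum_const, smul_eq_mul,
      smul_eq_mul, ← add_mul]
    refine Nat.mul_le_mul_right _ (le_trans (le_of_eq ?_) (hd s hs))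
    rw [Finset.filter_or, Finset.card_union_of_disjoint]
    rw [Finset.disjoint_filter]
    exact fun t _ h h' => lt_asymm h h'
  calc Fintype.card X * ∑ s ∈ F, (prefixed s).card
      ≤ Fintype.card X * ((Fintype.card X).factorial +
      ∑ p ∈ (F ×ˢ F).filter (fun p => p.1 ⊂ p.2), (prefixed p.1 ∩ prefixed p.2).card) :=
        Nat.mul_le_mul_left _ hcount
    _ ≤ _ := by
      rw [mul_add, Finset.mul_sum]
      refine Nat.add_le_add_left (le_trans (Finset.sum_le_sum fun p hp => ?_) hdeg) _
      obtain ⟨hp, hlt⟩ := Finset.mem_filter.1 hp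
      obtain ⟨hp1, hp2⟩ := Finset.mem_product.1 hp
      exact card_mul_card_prefixed_inter_le hlt (fun h => h0 (h ▸ hp1)) (fun h => h1 (h ▸ hp2))

theorem factorial_le_card_prefixed_mul_choose (s : Finset X) :
    (Fintype.card X).factorial ≤
      (prefixed s).card * (Fintype.card X).choose (Fintype.card X / 2) := by
  rw [card_prefixed, ← Nat.choose_mul_factorial_mul_factorial s.card_le_univ, mul_assoc, mul_comm]
  exact Nat.mul_le_mul_left _ (Nat.choose_le_middle _ _)

end Numbering

/-- A family of proper nonempty sets, each comparable to at most `d` others, is small. -/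
theorem card_le_of_card_comparable_le {X : Type*} [Fintype X] [DecidableEq X]
    {F : Finset (Finset X)} (h0 : ∅ ∉ F) (h1 : Finset.univ ∉ F) {d : ℕ}
    (hd : ∀ s ∈ F, (F.filter fun t => s < t ∨ t < s).card ≤ d) :
    (Fintype.card X - d) * F.card ≤
      Fintype.card X * (Fintype.card X).choose (Fintype.card X / 2) := by
  have h := Numbering.sum_card_prefixed_le h0 h1 hd
  have hF : F.card * (Fintype.card X).factorial ≤
      (∑ s ∈ F, (Numbering.prefixed s).card) *
        (Fintype.card X).choose (Fintype.card X / 2) := by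
    rw [Finset.sum_mul, ← smul_eq_mul, ← Finset.sum_const]
    exact Finset.sum_le_sum fun s _ => Numbering.factorial_le_card_prefixed_mul_choose s
  have hpos := (Fintype.card X).factorial_pos
  generalize ∑ s ∈ F, (Numbering.prefixed s).card = σ at *
  generalize Fintype.card X = n at *
  refine Nat.le_of_mul_le_mul_right ?_ hpos
  calc (n - d) * F.card * n.factorial = (n - d) * (F.card * n.factorial) := by ring
    _ ≤ (n - d) * (σ * n.choose (n / 2)) := Nat.mul_le_mul_left _ hF
    _ = (n * σ - d * σ) * n.choose (n / 2) := by rw [← Nat.sub_mul]; ring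
    _ ≤ (n * n.factorial) * n.choose (n / 2) := Nat.mul_le_mul_right _ (by omega)
    _ = _ := by ring

/-! ### Counting independent sets by branching. -/

/-- The graph joining distinct comparable elements. -/
def comparabilityGraph (α : Type*) [Preorder α] : SimpleGraph α where
  Adj a b := a < b ∨ b < a
  symm := ⟨fun _ _ h => h.symm⟩
  loopless := ⟨fun _ h => h.elim (lt_irrefl _) (lt_irrefl _)⟩

open Classical in
/-- The number of independent sets inside a given finite set of vertices. -/
noncomputable def SimpleGraph.numIndep {V : Type*} (G : SimpleGraph V) (S : Finset V) : ℕ :=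
  (S.powerset.filter fun I : Finset V => G.IsIndepSet (I : Set V)).card

open Classical in
theorem SimpleGraph.numIndep_le_add {V : Type*} (G : SimpleGraph V) (S : Finset V) (v : V) :
    G.numIndep S ≤ G.numIndep (S.erase v) +
      G.numIndep ((S.erase v).filter fun w => ¬ G.Adj v w) := by
  unfold SimpleGraph.numIndep
  rw [← Finset.card_filter_add_card_filter_not (p := fun I : Finset V => v ∉ I)]
  refine Nat.add_le_add (Finset.card_le_card fun I hI => ?_)
    (Finset.card_le_card_of_injOn (fun I => I.erase v) ?_ ?_)
  · simp only [Finset.mem_filter, Finset.mem_powerset] at hI ⊢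
    exact ⟨Finset.subset_erase.2 ⟨hI.1.1, hI.2⟩, hI.1.2⟩
  · intro I hI
    simp only [Finset.coe_filter, Finset.mem_filter, Finset.mem_powerset, not_not] at hI ⊢
    obtain ⟨⟨hIS, hI⟩, hvI⟩ := hI
    refine ⟨fun w hw => ?_, hI.mono (by simp)⟩
    obtain ⟨hwv, hwI⟩ := Finset.mem_erase.1 hw
    exact Finset.mem_filter.2 ⟨Finset.mem_erase.2 ⟨hwv, hIS hwI⟩, hI hvI hwI hwv.symm⟩
  · intro I hI J hJ hIJ
    simp only [Finset.coe_filter, Finset.mem_filter, not_not] at hI hJ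
    rw [← Finset.insert_erase hI.2, ← Finset.insert_erase hJ.2]
    exact congrArg (insert v) hIJ

-- Strong induction on `|S|`. Up to size `m` all subsets are counted. Beyond that, branching on a
-- vertex of degree at least `d` gives `(1+t)^(s-1) + (1+t)^(s-1-d) ≤ (1+t)^s`, which is what `htd`
-- ensures.
open Classical in
theorem SimpleGraph.numIndep_le {V : Type*} (G : SimpleGraph V) {S₀ : Finset V} {m d : ℕ}
    (hdeg : ∀ S ⊆ S₀, m < S.card → ∃ v ∈ S, d ≤ (S.filter fun w => G.Adj v w).card)
    {t : ℝ} (ht : 0 ≤ t) (htd : 1 ≤ t * (1 + t) ^ d) :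
    (G.numIndep S₀ : ℝ) ≤ 2 ^ m * (1 + t) ^ S₀.card := by
  have h1t : (1 : ℝ) ≤ 1 + t := by linarith
  suffices H : ∀ s : ℕ, ∀ S ⊆ S₀, S.card = s → (G.numIndep S : ℝ) ≤ 2 ^ m * (1 + t) ^ s from
    H _ S₀ subset_rfl rfl
  intro s
  induction s using Nat.strong_induction_on with
  | _ s ih =>
  intro S hS hs
  rcases le_or_gt S.card m with hm | hm
  · have h : G.numIndep S ≤ 2 ^ m := by
      refine (Finset.card_filter_le _ _).trans ?_
      rw [Finset.card_powerset]
      exact Nat.pow_le_pow_right (by norm_num) hm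
    calc (G.numIndep S : ℝ) ≤ 2 ^ m := by exact_mod_cast h
      _ ≤ 2 ^ m * (1 + t) ^ s := le_mul_of_one_le_right (by positivity) (one_le_pow₀ h1t)
  · obtain ⟨v, hv, hvd⟩ := hdeg S hS hm
    have hE : (S.erase v).card = s - 1 := by rw [Finset.card_erase_of_mem hv, hs]
    have hspos : 0 < s := hs ▸ Finset.card_pos.2 ⟨v, hv⟩
    set T := (S.erase v).filter fun w => ¬ G.Adj v w with hT
    have hTcard : T.card + d ≤ s - 1 := by
      rw [← hE, ← Finset.card_filter_add_card_filter_not (s := S.erase v)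
        (p := fun w => G.Adj v w), add_comm]
      refine Nat.add_le_add (hvd.trans (Finset.card_le_card fun w hw => ?_)) le_rfl
      rw [Finset.mem_filter] at hw ⊢
      exact ⟨Finset.mem_erase.2 ⟨hw.2.ne', hw.1⟩, hw.2⟩
    have hTS : T ⊆ S₀ := (Finset.filter_subset _ _).trans ((Finset.erase_subset _ _).trans hS)
    have i1 := ih (s - 1) (by omega) (S.erase v) ((Finset.erase_subset _ _).trans hS) hE
    have i2 := ih T.card (by omega) T hTS rfl
    have hsplit : (G.numIndep S : ℝ) ≤ G.numIndep (S.erase v) + G.numIndep T := by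
      exact_mod_cast G.numIndep_le_add S v
    have hkey : (1 + t) ^ T.card ≤ t * (1 + t) ^ (s - 1) := by
      calc (1 + t) ^ T.card ≤ (1 + t) ^ T.card * (t * (1 + t) ^ d) :=
            le_mul_of_one_le_right (by positivity) htd
        _ = t * (1 + t) ^ (T.card + d) := by rw [pow_add]; ring
        _ ≤ t * (1 + t) ^ (s - 1) :=
            mul_le_mul_of_nonneg_left (pow_le_pow_right₀ h1t hTcard) ht
    calc (G.numIndep S : ℝ) ≤ 2 ^ m * (1 + t) ^ (s - 1) + 2 ^ m * (1 + t) ^ T.card := by linarith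
      _ ≤ 2 ^ m * (1 + t) ^ (s - 1) + 2 ^ m * (t * (1 + t) ^ (s - 1)) := by gcongr
      _ = 2 ^ m * ((1 + t) ^ (s - 1) * (1 + t)) := by ring
      _ = 2 ^ m * (1 + t) ^ s := by rw [← pow_succ, Nat.sub_add_cancel hspos]

-- Meant for `a = ∅`, `b = univ`, which the chain argument excludes; recording their membership
-- costs the factor 4.
open Classical in
theorem card_antichain_le_four_mul_numIndep {α : Type*} [PartialOrder α] [Fintype α] (a b : α) :
    Nat.card {A : Set α // IsAntichain (· ≤ ·) A} ≤
      4 * (comparabilityGraph α).numIndep (Finset.univ.filter fun s => s ≠ a ∧ s ≠ b) := by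
  set S : Finset α := Finset.univ.filter fun s => s ≠ a ∧ s ≠ b
  unfold SimpleGraph.numIndep
  set 𝓘 : Finset (Finset α) :=
    S.powerset.filter fun I : Finset α => (comparabilityGraph α).IsIndepSet (I : Set α)
  have hcard : Nat.card (Prop × Prop × 𝓘) = 4 * 𝓘.card := by
    rw [Nat.card_prod, Nat.card_prod, Nat.card_eq_fintype_card (α := Prop), Fintype.card_prop,
      Nat.card_eq_fintype_card, Fintype.card_coe, ← mul_assoc]
    norm_num
  have hmem : ∀ A : {A : Set α // IsAntichain (· ≤ ·) A}, S.filter (· ∈ A.1) ∈ 𝓘 := by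
    intro A
    refine Finset.mem_filter.2 ⟨Finset.mem_powerset.2 (Finset.filter_subset _ _), ?_⟩
    intro s hs t ht hst hadj
    have hs' := (Finset.mem_filter.1 (Finset.mem_coe.1 hs)).2
    have ht' := (Finset.mem_filter.1 (Finset.mem_coe.1 ht)).2
    rcases hadj with h | h
    · exact A.2 hs' ht' hst h.le
    · exact A.2 ht' hs' hst.symm h.le
  let φ : {A : Set α // IsAntichain (· ≤ ·) A} → Prop × Prop × 𝓘 :=
    fun A => (a ∈ A.1, b ∈ A.1, ⟨S.filter (· ∈ A.1), hmem A⟩)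
  have hφ : Function.Injective φ := by
    intro A B hAB
    have h0 : (a ∈ A.1) = (a ∈ B.1) := congrArg Prod.fst hAB
    have h1 : (b ∈ A.1) = (b ∈ B.1) := congrArg (fun p => p.2.1) hAB
    have h2 : S.filter (· ∈ A.1) = S.filter (· ∈ B.1) := congrArg (fun p => p.2.2.1) hAB
    refine Subtype.ext (Set.ext fun s => ?_)
    by_cases hs0 : s = a
    · rw [hs0, h0]
    by_cases hs1 : s = b
    · rw [hs1, h1]
    have hs : s ∈ S := Finset.mem_filter.2 ⟨Finset.mem_univ _, hs0, hs1⟩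
    have h3 := Finset.ext_iff.1 h2 s
    exact ⟨fun h => (Finset.mem_filter.1 (h3.1 (Finset.mem_filter.2 ⟨hs, h⟩))).2,
      fun h => (Finset.mem_filter.1 (h3.2 (Finset.mem_filter.2 ⟨hs, h⟩))).2⟩
  exact (Nat.card_le_card_of_injective φ hφ).trans_eq hcard

theorem numAntichains_le {n d : ℕ} (hd : d < n) {t : ℝ} (ht : 0 ≤ t)
    (htd : 1 ≤ t * (1 + t) ^ (d + 1)) :
    (numAntichains n : ℝ) ≤
      4 * (2 ^ (n * n.choose (n / 2) / (n - d)) * (1 + t) ^ (2 ^ n)) := by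
  classical
  have hle := card_antichain_le_four_mul_numIndep (∅ : Finset (Fin n)) Finset.univ
  set S : Finset (Finset (Fin n)) := Finset.univ.filter fun s => s ≠ ∅ ∧ s ≠ Finset.univ
  have hScard : S.card ≤ 2 ^ n := by
    simpa using S.card_le_univ
  have h := (comparabilityGraph (Finset (Fin n))).numIndep_le (S₀ := S)
    (m := n * n.choose (n / 2) / (n - d)) (d := d + 1) ?_ ht htd
  · calc (numAntichains n : ℝ)
        ≤ 4 * ((comparabilityGraph (Finset (Fin n))).numIndep S : ℝ) := by
          exact_mod_cast hle
      _ ≤ _ := by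
        refine mul_le_mul_of_nonneg_left (h.trans ?_) (by norm_num)
        gcongr
        linarith
  · intro F hF hlt
    by_contra! hcon
    have := card_le_of_card_comparable_le (F := F) (d := d)
      (fun h0 => (Finset.mem_filter.1 (hF h0)).2.1 rfl)
      (fun h1 => (Finset.mem_filter.1 (hF h1)).2.2 rfl)
      (fun s hs => Nat.lt_succ_iff.1 (lt_of_le_of_lt (Finset.card_le_card fun u hu => by
        rw [Finset.mem_filter] at hu ⊢; exact hu) (hcon s hs)))
    rw [Fintype.card_fin, mul_comm] at this
    exact absurd ((Nat.le_div_iff_mul_le (by omega)).2 this) (by omega)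

/-! ### The middle layer and the logarithm of the number of antichains. -/

theorem two_pow_choose_le_numAntichains (n : ℕ) :
    2 ^ n.choose (n / 2) ≤ numAntichains n := by
  classical
  have hcard : Nat.card ((Finset.univ : Finset (Fin n)).powersetCard (n / 2)).powerset =
      2 ^ n.choose (n / 2) := by
    rw [Nat.card_eq_fintype_card, Fintype.card_coe]
    simp
  rw [← hcard]
  refine Nat.card_le_card_of_injective (fun F => ⟨(F.1 : Set (Finset (Fin n))), ?_⟩) ?_
  · intro s hs t ht hst hle
    have hF := Finset.mem_powerset.1 F.2
    have h1 := (Finset.mem_powersetCard.1 (hF hs)).2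
    have h2 := (Finset.mem_powersetCard.1 (hF ht)).2
    exact hst (Finset.eq_of_subset_of_card_le hle (by omega))
  · intro F G h
    exact Subtype.ext (Finset.coe_injective (congrArg Subtype.val h))

theorem sixteen_pow_le_four_mul_centralBinom_sq {k : ℕ} (hk : 0 < k) :
    16 ^ k ≤ 4 * k * k.centralBinom ^ 2 := by
  induction k, hk using Nat.le_induction with
  | base => decide
  | succ k hk ih =>
    have h := Nat.succ_mul_centralBinom_succ k
    refine Nat.le_of_mul_le_mul_right (?_ : _ * (k + 1) ≤ _ * (k + 1)) k.succ_pos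
    calc 16 ^ (k + 1) * (k + 1) = 16 ^ k * (16 * (k + 1)) := by ring
      _ ≤ 4 * k * k.centralBinom ^ 2 * (16 * (k + 1)) := Nat.mul_le_mul_right _ ih
      _ = k.centralBinom ^ 2 * (16 * (4 * k * (k + 1))) := by ring
      _ ≤ k.centralBinom ^ 2 * (16 * (2 * k + 1) ^ 2) :=
        Nat.mul_le_mul_left _ (Nat.mul_le_mul_left _ (by nlinarith))
      _ = 4 * (2 * (2 * k + 1) * k.centralBinom) ^ 2 := by ring
      _ = 4 * ((k + 1) * (k + 1).centralBinom) ^ 2 := by rw [h]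
      _ = _ := by ring

/-- The middle binomial coefficient is at least `2 ^ n / (2 √n)`. -/
theorem four_pow_le_four_mul_choose_half_sq {n : ℕ} (hn : 0 < n) :
    4 ^ n ≤ 4 * n * n.choose (n / 2) ^ 2 := by
  obtain ⟨k, rfl | rfl⟩ := Nat.even_or_odd' n
  · have h := sixteen_pow_le_four_mul_centralBinom_sq (k := k) (by omega)
    rw [Nat.mul_div_cancel_left k two_pos, ← Nat.centralBinom_eq_two_mul_choose, pow_mul]
    norm_num
    nlinarith
  · have h := sixteen_pow_le_four_mul_centralBinom_sq k.succ_pos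
    have hc : (k + 1).centralBinom = 2 * (2 * k + 1).choose k := by
      rw [Nat.centralBinom_eq_two_mul_choose, show 2 * (k + 1) = 2 * k + 1 + 1 by ring,
        Nat.choose_succ_succ', Nat.choose_symm_half]
      ring
    rw [Nat.succ_eq_add_one, hc, pow_succ] at h
    rw [show (2 * k + 1) / 2 = k by omega, pow_succ, pow_mul]
    norm_num at h ⊢
    nlinarith [Nat.zero_le (k * (2 * k + 1).choose k ^ 2)]

theorem le_choose_half (n : ℕ) : n ≤ n.choose (n / 2) := by
  simpa using Nat.choose_le_middle 1 n

open Filter Topology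

theorem logb_two_numAntichains_le {n k : ℕ} (hk : 0 < k) (hkn : 2 * k ^ 3 < n) :
    Real.logb 2 (numAntichains n) ≤
      n.choose (n / 2) * (1 - 2 * ((k : ℝ) ^ 3 / n))⁻¹ + 2 + 2 * 2 ^ n / (k : ℝ) ^ 2 := by
  have hk0 : (0 : ℝ) < k := by exact_mod_cast hk
  have hn0 : (0 : ℝ) < n := by exact_mod_cast (by omega : 0 < n)
  -- With `d = 2k³`, Bernoulli gives `(1+t)^(k³) ≥ 1 + k`; squaring beats `k² = 1/t`.
  set t : ℝ := 1 / (k : ℝ) ^ 2 with ht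
  have ht0 : 0 < t := by positivity
  have hbern : 1 + (k : ℝ) ≤ (1 + t) ^ k ^ 3 := by
    have h := one_add_mul_le_pow (a := t) (by linarith) (k ^ 3)
    refine le_trans (le_of_eq ?_) h
    rw [ht]
    push_cast
    field_simp
  have htd : 1 ≤ t * (1 + t) ^ (2 * k ^ 3 + 1) := by
    calc (1 : ℝ) = t * (k : ℝ) ^ 2 := by rw [ht]; field_simp
      _ ≤ t * ((1 + t) ^ k ^ 3) ^ 2 := by gcongr; linarith
      _ = t * (1 + t) ^ (2 * k ^ 3) := by rw [← pow_mul, mul_comm 2]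
      _ ≤ t * (1 + t) ^ (2 * k ^ 3 + 1) := by
        gcongr
        · linarith
        · omega
  have h := numAntichains_le hkn ht0.le htd
  have hpos : (0 : ℝ) < numAntichains n := by
    exact_mod_cast (Nat.two_pow_pos _).trans_le (two_pow_choose_le_numAntichains n)
  have hlog := Real.logb_le_logb_of_le one_lt_two hpos h
  rw [Real.logb_mul (by norm_num) (by positivity), Real.logb_mul (by positivity) (by positivity),
    Real.logb_pow, Real.logb_pow, Real.logb_self_eq_one one_lt_two,
    show (4 : ℝ) = 2 ^ 2 by norm_num, Real.logb_pow, Real.logb_self_eq_one one_lt_two] at hlog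
  have hdiv : ((n * n.choose (n / 2) / (n - 2 * k ^ 3) : ℕ) : ℝ) ≤
      n.choose (n / 2) * (1 - 2 * ((k : ℝ) ^ 3 / n))⁻¹ := by
    refine Nat.cast_div_le.trans (le_of_eq ?_)
    have hkn' : (2 * (k : ℝ) ^ 3) < n := by exact_mod_cast hkn
    rw [Nat.cast_sub hkn.le]
    push_cast
    have h1 : (n : ℝ) - 2 * (k : ℝ) ^ 3 ≠ 0 := by linarith
    have h2 : 1 - 2 * ((k : ℝ) ^ 3 / n) = (n - 2 * (k : ℝ) ^ 3) / n := by field_simp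
    rw [h2, inv_div]
    ring
  have hlogt : Real.logb 2 (1 + t) ≤ 2 * t := by
    have h1 := Real.log_le_sub_one_of_pos (x := 1 + t) (by linarith)
    have h2 := Real.log_two_gt_d9
    rw [Real.logb, div_le_iff₀ (by linarith)]
    nlinarith
  have hlast : ((2 ^ n : ℕ) : ℝ) * Real.logb 2 (1 + t) ≤ 2 * 2 ^ n / (k : ℝ) ^ 2 := by
    calc ((2 ^ n : ℕ) : ℝ) * Real.logb 2 (1 + t) ≤ ((2 ^ n : ℕ) : ℝ) * (2 * t) := by gcongr
      _ = _ := by rw [ht]; push_cast; ring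
  push_cast at hlog hlast hdiv ⊢
  linarith

theorem two_pow_le_mul_choose_half {n : ℕ} (hn : 0 < n) :
    (2 : ℝ) ^ n ≤ 2 * √n * n.choose (n / 2) := by
  refine (sq_le_sq₀ (by positivity) (by positivity)).1 ?_
  rw [mul_pow, mul_pow, Real.sq_sqrt (Nat.cast_nonneg n), ← pow_mul, mul_comm n 2, pow_mul]
  have h : ((4 ^ n : ℕ) : ℝ) ≤ ((4 * n * n.choose (n / 2) ^ 2 : ℕ) : ℝ) := by
    exact_mod_cast four_pow_le_four_mul_choose_half_sq hn
  push_cast at h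
  norm_num
  linarith

/-! ### Choice of the parameter and the error terms. -/

/-- The parameter of order `n ^ (3 / 10)` balancing the error terms. -/
noncomputable def degreeParam (n : ℕ) : ℕ := ⌈(n : ℝ) ^ (3 / 10 : ℝ)⌉₊

theorem degreeParam_pos {n : ℕ} (hn : 0 < n) : 0 < degreeParam n :=
  Nat.ceil_pos.2 (Real.rpow_pos_of_pos (by exact_mod_cast hn) _)

/-- `k³/n → 0` needs an exponent below `1/3`, `√n/k² → 0` one above `1/4`. With `3/10` both decay
like `n^(-1/10)`. -/
theorem tendsto_rpow_neg_tenth :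
    Tendsto (fun n : ℕ => (n : ℝ) ^ (-(1 / 10) : ℝ)) atTop (𝓝 0) :=
  (tendsto_rpow_neg_atTop (by norm_num)).comp tendsto_natCast_atTop_atTop

theorem tendsto_degreeParam_cube_div :
    Tendsto (fun n : ℕ => (degreeParam n : ℝ) ^ 3 / n) atTop (𝓝 0) := by
  have h8 : Tendsto (fun n : ℕ => 8 * (n : ℝ) ^ (-(1 / 10) : ℝ)) atTop (𝓝 0) := by
    simpa using tendsto_rpow_neg_tenth.const_mul 8
  refine tendsto_of_tendsto_of_tendsto_of_le_of_le' tendsto_const_nhds h8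
    (Eventually.of_forall fun n => by positivity) ?_
  filter_upwards [eventually_ge_atTop 1] with n hn
  have hn1 : (1 : ℝ) ≤ n := by exact_mod_cast hn
  have h1 : (1 : ℝ) ≤ (n : ℝ) ^ (3 / 10 : ℝ) := Real.one_le_rpow hn1 (by norm_num)
  have h2 : (degreeParam n : ℝ) ≤ 2 * (n : ℝ) ^ (3 / 10 : ℝ) := by
    have := Nat.ceil_lt_add_one (a := (n : ℝ) ^ (3 / 10 : ℝ)) (by linarith)
    unfold degreeParam
    linarith
  rw [div_le_iff₀ (by linarith)]
  calc (degreeParam n : ℝ) ^ 3 ≤ (2 * (n : ℝ) ^ (3 / 10 : ℝ)) ^ 3 := by gcongr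
    _ = 8 * (n : ℝ) ^ (9 / 10 : ℝ) := by
      rw [mul_pow, ← Real.rpow_mul_natCast (by linarith)]
      norm_num
    _ = 8 * (n : ℝ) ^ (-(1 / 10) : ℝ) * n := by
      rw [mul_assoc, ← Real.rpow_add_one (by linarith)]
      norm_num

theorem tendsto_sqrt_div_degreeParam_sq :
    Tendsto (fun n : ℕ => √(n : ℝ) / (degreeParam n : ℝ) ^ 2) atTop (𝓝 0) := by
  refine tendsto_of_tendsto_of_tendsto_of_le_of_le' tendsto_const_nhds tendsto_rpow_neg_tenth
    (Eventually.of_forall fun n => by positivity) ?_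
  filter_upwards [eventually_ge_atTop 1] with n hn
  have hn1 : (1 : ℝ) ≤ n := by exact_mod_cast hn
  have hk : (0 : ℝ) < degreeParam n := by exact_mod_cast degreeParam_pos hn
  have h2 : (n : ℝ) ^ (3 / 10 : ℝ) ≤ degreeParam n := Nat.le_ceil _
  rw [div_le_iff₀ (by positivity)]
  calc √(n : ℝ) = (n : ℝ) ^ (-(1 / 10) : ℝ) * ((n : ℝ) ^ (3 / 10 : ℝ)) ^ 2 := by
        rw [← Real.rpow_mul_natCast (by linarith), ← Real.rpow_add (by linarith),
          Real.sqrt_eq_rpow]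
        norm_num
    _ ≤ _ := by gcongr

/-- An explicit bound for the relative error of `logb 2 (numEmbeddings n N)`. -/
noncomputable def errorBound (n : ℕ) : ℝ :=
  ((1 - 2 * ((degreeParam n : ℝ) ^ 3 / n))⁻¹ - 1) + 2 * (n : ℝ)⁻¹ +
    4 * (√n / (degreeParam n : ℝ) ^ 2) + 2 * ((n : ℝ) ^ 3 / 2 ^ n + (n : ℝ) ^ 2 / 2 ^ n)

theorem tendsto_errorBound : Tendsto errorBound atTop (𝓝 0) := by
  have h1 : Tendsto (fun n : ℕ => (1 - 2 * ((degreeParam n : ℝ) ^ 3 / n))⁻¹) atTop (𝓝 1) := by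
    simpa using ((tendsto_degreeParam_cube_div.const_mul 2).const_sub 1).inv₀ (by norm_num)
  have h2 : Tendsto (fun n : ℕ => 2 * (n : ℝ)⁻¹) atTop (𝓝 0) := by
    simpa using (tendsto_inv_atTop_nhds_zero_nat (𝕜 := ℝ)).const_mul 2
  have h4 : Tendsto (fun n : ℕ => 2 * ((n : ℝ) ^ 3 / 2 ^ n + (n : ℝ) ^ 2 / 2 ^ n)) atTop (𝓝 0) := by
    simpa using ((tendsto_pow_const_div_const_pow_of_one_lt 3 (one_lt_two (α := ℝ))).add
      (tendsto_pow_const_div_const_pow_of_one_lt 2 (one_lt_two (α := ℝ)))).const_mul 2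
  have : Tendsto errorBound atTop (𝓝 _) := (((h1.sub_const 1).add h2).add (tendsto_sqrt_div_degreeParam_sq.const_mul 4)).add h4
  simpa using this

/-! ### Asymptotics of the number of embeddings. -/

theorem choose_half_pos (n : ℕ) : 0 < n.choose (n / 2) := Nat.choose_pos (Nat.div_le_self n 2)

theorem lt_numAntichains (n : ℕ) : n < numAntichains n :=
  ((le_choose_half n).trans_lt Nat.lt_two_pow_self).trans_le (two_pow_choose_le_numAntichains n)

theorem one_le_descFactorial {n N : ℕ} (h : n ≤ N) : 1 ≤ N.descFactorial n :=
  Nat.pos_of_ne_zero fun h0 => absurd (Nat.descFactorial_eq_zero_iff_lt.1 h0) (by omega)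

theorem numEmbeddings_pos {n N : ℕ} (h : n ≤ N) : 0 < numEmbeddings n N :=
  (Nat.mul_pos (one_le_descFactorial h)
    (pow_pos (Nat.sub_pos_of_lt (lt_numAntichains n)) _)).trans_le (le_numEmbeddings n N)

theorem le_logb_two_numEmbeddings {n N : ℕ} (hn : 0 < n) (h : n ≤ N) :
    ((N : ℝ) - n) * ((n.choose (n / 2) : ℝ) - 1) ≤ Real.logb 2 (numEmbeddings n N) := by
  have hM := le_choose_half n
  -- Since `n ≤ 2^(n-1) ≤ 2^(M-1)`, subtracting `n` costs at most half of `2^M`.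
  have hhalf : 2 ^ (n.choose (n / 2) - 1) ≤ numAntichains n - n := by
    have h1 := two_pow_choose_le_numAntichains n
    have h2 : n ≤ 2 ^ (n.choose (n / 2) - 1) := by
      have : n - 1 < 2 ^ (n - 1) := Nat.lt_two_pow_self
      have h3 : 2 ^ (n - 1) ≤ 2 ^ (n.choose (n / 2) - 1) :=
        Nat.pow_le_pow_right two_pos (by omega)
      omega
    have h3 : 2 ^ n.choose (n / 2) = 2 ^ (n.choose (n / 2) - 1) * 2 := by
      rw [← pow_succ, Nat.sub_add_cancel (by omega)]
    omega
  have hle : 2 ^ ((n.choose (n / 2) - 1) * (N - n)) ≤ numEmbeddings n N := by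
    rw [pow_mul]
    calc _ ≤ 1 * (numAntichains n - n) ^ (N - n) := by
          rw [one_mul]; exact Nat.pow_le_pow_left hhalf _
      _ ≤ N.descFactorial n * (numAntichains n - n) ^ (N - n) :=
        Nat.mul_le_mul_right _ (one_le_descFactorial h)
      _ ≤ _ := le_numEmbeddings n N
  have hlog := Real.logb_le_logb_of_le (b := 2) one_lt_two
    (x := 2 ^ ((n.choose (n / 2) - 1) * (N - n))) (y := numEmbeddings n N)
    (by positivity) (by exact_mod_cast hle)
  rw [Real.logb_pow, Real.logb_self_eq_one one_lt_two, mul_one, Nat.cast_mul, Nat.cast_sub h,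
    Nat.cast_sub (by omega), Nat.cast_one, mul_comm] at hlog
  exact hlog

theorem logb_two_numEmbeddings_le {n N : ℕ} (h : n < N) :
    Real.logb 2 (numEmbeddings n N) ≤
      ((N : ℝ) - n) * ((n : ℝ) ^ 2 + n + Real.logb 2 (numAntichains n)) := by
  have ha := lt_numAntichains n
  have ha0 : (0 : ℝ) < numAntichains n := by exact_mod_cast (Nat.zero_le n).trans_lt ha
  -- Because `N - n ≥ 1`, the exponent `Nn` is at most `(n² + n)(N - n)`; this makes the error
  -- uniform in `N`.
  have hdesc : N.descFactorial n ≤ 2 ^ ((n ^ 2 + n) * (N - n)) := by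
    calc N.descFactorial n ≤ N ^ n := Nat.descFactorial_le_pow N n
      _ ≤ (2 ^ N) ^ n := Nat.pow_le_pow_left Nat.lt_two_pow_self.le n
      _ = 2 ^ (N * n) := (pow_mul _ _ _).symm
      _ ≤ _ := by
        refine Nat.pow_le_pow_right two_pos ?_
        obtain ⟨r, rfl⟩ : ∃ r, N = n + (r + 1) := ⟨N - n - 1, by omega⟩
        rw [Nat.add_sub_cancel_left]
        nlinarith [Nat.zero_le (n ^ 2 * r)]
  have hle : numEmbeddings n N ≤
      2 ^ ((n ^ 2 + n) * (N - n)) * numAntichains n ^ (N - n) :=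
    (numEmbeddings_le n N).trans (Nat.mul_le_mul_right _ hdesc)
  have hlog := Real.logb_le_logb_of_le (b := 2) one_lt_two (x := numEmbeddings n N)
    (y := 2 ^ ((n ^ 2 + n) * (N - n)) * (numAntichains n : ℝ) ^ (N - n))
    (by exact_mod_cast numEmbeddings_pos h.le) (by exact_mod_cast hle)
  rw [Real.logb_mul (by positivity) (by positivity), Real.logb_pow, Real.logb_pow,
    Real.logb_self_eq_one one_lt_two, mul_one, Nat.cast_mul, Nat.cast_sub h.le] at hlog
  push_cast at hlog
  linarith

theorem abs_logb_two_numEmbeddings_div_sub_one_le {n N : ℕ} (hn : 0 < n)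
    (hkn : 2 * degreeParam n ^ 3 < n) (h : n < N) :
    |Real.logb 2 (numEmbeddings n N) / (n.choose (n / 2) * ((N : ℝ) - n)) - 1| ≤
      errorBound n := by
  have hup := logb_two_numEmbeddings_le h
  have hlow := le_logb_two_numEmbeddings hn h.le
  have hant := logb_two_numAntichains_le (degreeParam_pos hn) hkn
  have hpow := two_pow_le_mul_choose_half hn
  have hMn : (n : ℝ) ≤ n.choose (n / 2) := by exact_mod_cast le_choose_half n
  have hn1 : (1 : ℝ) ≤ n := by exact_mod_cast hn
  have hr : (0 : ℝ) < (N : ℝ) - n := sub_pos.2 (by exact_mod_cast h)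
  have hk : (0 : ℝ) < degreeParam n := by exact_mod_cast degreeParam_pos hn
  have hkn' : 2 * ((degreeParam n : ℝ) ^ 3 / n) < 1 := by
    rw [← mul_div_assoc, div_lt_one (by linarith)]
    exact_mod_cast hkn
  have hinv : 1 ≤ (1 - 2 * ((degreeParam n : ℝ) ^ 3 / n))⁻¹ := by
    refine (one_le_inv₀ (by linarith)).2 ?_
    have : 0 ≤ (degreeParam n : ℝ) ^ 3 / n := by positivity
    linarith
  unfold errorBound
  set M : ℝ := (n.choose (n / 2) : ℝ)
  set P : ℝ := (1 - 2 * ((degreeParam n : ℝ) ^ 3 / n))⁻¹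
  set L := Real.logb 2 (numEmbeddings n N)
  have hM : 0 < M := by linarith
  have hs : √(n : ℝ) ≤ n := Real.sqrt_le_iff.2 ⟨by linarith, by nlinarith⟩
  -- The additive errors become multiples of `M`: the `2` coming from the factor 4 by `n ≤ M`, the
  -- branching term by `2^n ≤ 2√n M`, and the falling factorial's `n² + n` by `2^n ≤ 2nM`.
  have e1 : 2 ≤ M * (2 * (n : ℝ)⁻¹) := by
    have : 1 ≤ M * (n : ℝ)⁻¹ := by
      rw [← div_eq_mul_inv]; exact (one_le_div (by linarith)).2 hMn
    linarith
  have e2 : 2 * 2 ^ n / (degreeParam n : ℝ) ^ 2 ≤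
      M * (4 * (√n / (degreeParam n : ℝ) ^ 2)) := by
    calc 2 * 2 ^ n / (degreeParam n : ℝ) ^ 2
        ≤ 2 * (2 * √n * M) / (degreeParam n : ℝ) ^ 2 := by gcongr
      _ = _ := by ring
  have e3 : (n : ℝ) ^ 2 + n ≤ M * (2 * ((n : ℝ) ^ 3 / 2 ^ n + (n : ℝ) ^ 2 / 2 ^ n)) := by
    have h1 : (2 : ℝ) ^ n ≤ 2 * n * M := hpow.trans (by gcongr)
    rw [← add_div, ← mul_div_assoc, ← mul_div_assoc, le_div_iff₀ (by positivity)]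
    calc ((n : ℝ) ^ 2 + n) * 2 ^ n ≤ ((n : ℝ) ^ 2 + n) * (2 * n * M) := by gcongr
      _ = _ := by ring
  have e4 : 0 ≤ 4 * (√n / (degreeParam n : ℝ) ^ 2) := by positivity
  have e5 : 0 ≤ 2 * ((n : ℝ) ^ 3 / 2 ^ n + (n : ℝ) ^ 2 / 2 ^ n) := by positivity
  have e6 : 0 ≤ (n : ℝ)⁻¹ := by positivity
  have hMr : 0 < M * ((N : ℝ) - n) := mul_pos hM hr
  rw [abs_le]
  constructor
  -- The lower bound loses only `1` from `M`, which the `2/n` term covers.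
  · have : 1 - 2 * (n : ℝ)⁻¹ ≤ L / (M * ((N : ℝ) - n)) := by
      rw [le_div_iff₀ hMr]
      refine le_trans ?_ hlow
      nlinarith
    linarith
  · rw [sub_le_iff_le_add, div_le_iff₀ hMr]
    refine hup.trans ?_
    rw [mul_comm M, mul_left_comm]
    refine mul_le_mul_of_nonneg_left ?_ hr.le
    linarith

theorem cast_descFactorial_eq_div {n N : ℕ} (h : n ≤ N) :
    (N.descFactorial n : ℝ) = (N.factorial : ℝ) / ((N - n).factorial : ℝ) := by
  rw [eq_div_iff (by positivity), mul_comm]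
  exact_mod_cast Nat.factorial_mul_descFactorial h

theorem theorem2 :
    (∀ n N : ℕ, n ≤ N →
      ((N.factorial : ℝ) / ((N - n).factorial : ℝ)) *
          ((numAntichains n : ℝ) - (n : ℝ)) ^ (N - n) ≤ (numEmbeddings n N : ℝ) ∧
      (numEmbeddings n N : ℝ) ≤
        ((N.factorial : ℝ) / ((N - n).factorial : ℝ)) * (numAntichains n : ℝ) ^ (N - n)) ∧
    (∃ ε : ℕ → ℕ → ℝ,
      (∀ n N : ℕ, n < N →
        (numEmbeddings n N : ℝ) =
          (2 : ℝ) ^ ((n.choose (n / 2) : ℝ) * ((N : ℝ) - (n : ℝ)) * (1 + ε n N))) ∧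
      (∀ η : ℝ, 0 < η → ∃ n₀ : ℕ, ∀ n N : ℕ, n₀ ≤ n → n < N → |ε n N| ≤ η)) := by
  refine ⟨fun n N h => ?_, fun n N =>
    Real.logb 2 (numEmbeddings n N) / (n.choose (n / 2) * ((N : ℝ) - n)) - 1, ?_, ?_⟩
  · rw [← cast_descFactorial_eq_div h, ← Nat.cast_sub (lt_numAntichains n).le]
    exact ⟨by exact_mod_cast le_numEmbeddings n N, by exact_mod_cast numEmbeddings_le n N⟩
  · intro n N h
    have hr : (0 : ℝ) < (N : ℝ) - n := sub_pos.2 (by exact_mod_cast h)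
    have hM : (0 : ℝ) < n.choose (n / 2) := by exact_mod_cast choose_half_pos n
    rw [add_sub_cancel, mul_div_cancel₀ _ (mul_pos hM hr).ne',
      Real.rpow_logb two_pos (by norm_num) (by exact_mod_cast numEmbeddings_pos h.le)]
  · intro η hη
    have hsmall : ∀ᶠ n : ℕ in atTop, (degreeParam n : ℝ) ^ 3 / n < 1 / 2 :=
      tendsto_degreeParam_cube_div.eventually_lt_const (by norm_num)
    obtain ⟨n₀, hn₀⟩ := eventually_atTop.1 (((tendsto_errorBound.eventually_le_const hη).and
      hsmall).and (eventually_ge_atTop 1))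
    refine ⟨n₀, fun n N hn hN => ?_⟩
    obtain ⟨⟨h1, h2⟩, h3⟩ := hn₀ n hn
    refine (abs_logb_two_numEmbeddings_div_sub_one_le h3 ?_ hN).trans h1
    rw [div_lt_iff₀ (by exact_mod_cast h3)] at h2
    have : (2 * (degreeParam n : ℝ) ^ 3) < n := by linarith
    exact_mod_cast this
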